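/- Let $L$ be the first-order language $(+,\cdot,-,0,1,\le)$ of ordered rings together with one additional unary function symbol $f$. Call an $L$-formula $\varphi$ (quantifiers allowed, free variables among $x_0,x_1,\dots$) *satisfiable over the reals* if there are a function $f:\mathbb{R}\to\mathbb{R}$ and real values of the free variables for which $\varphi$ is true in the ordered field $\mathbb{R}$ expanded by $f$ (quantifiers range over $\mathbb{R}$). Then: 1. Real arithmetic with one unary uninterpreted function is undecidable: there is no algorithm (computable function on Gödel numbers) that, given an $L$-formula $\varphi$, decides whether $\varphi$ is satisfiable over the reals. 2. Let $A$ be the conjunction of the sentences $\forall x\,(f(x)+1=f(x+1))$ and $\forall x\,(0\le x\wedge x<1\rightarrow f(x)=0)$. A function $f:\mathbb{R}\to\mathbb{R}$ satisfies $A$ if and only if $f(x)=\lfloor x\rfloor$ for all $x\in\mathbb{R}$. With this $f$, the conjunction $\bigwedge_{i<n}(x_i=f(x_i))$ holds if and only if $x_0,\dots,x_{n-1}$ are all integers. 3. For a formula $F$ in the language of ordered rings (without $f$) and $n\in\mathbb{N}$ put $F_n:=A\wedge\bigwedge_{i<n}(x_i=f(x_i))\wedge F$. A Gödel number of $F_n$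 can be computed from $n$ and a Gödel number of $F$. If $F$ is quantifier-free and all its variables are among $x_0,\dots,x_{n-1}$ (for instance, if $F$ is a Diophantine equation $P(x_0,\dots,x_{n-1})=0$ with $P\in\mathbb{Z}[x_0,\dots,x_{n-1}]$), then $F$ is satisfiable over $\mathbb{Z}$ if and only if $F_n$ is satisfiable over the reals. -/

import Mathlib

open FirstOrder FirstOrder.Language

namespace RealUF

/-- The function symbols of the language with one unary function symbol `f`. -/
inductive UnaryFunc : ℕ → Type
  | f : UnaryFunc 1

/-- The language with one unary function symbol `f` and nothing else. -/
def unaryLang : Language := ⟨UnaryFunc, fun _ => Empty⟩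

/-- The language `(+, *, -, 0, 1, ≤)` of ordered rings. -/
abbrev orderedRing : Language := Language.ring.sum Language.order

/-- The language of ordered rings together with one unary function symbol `f`. -/
abbrev orderedRingF : Language := orderedRing.sum unaryLang

instance : orderedRingF.IsOrdered := ⟨Sum.inl (Sum.inr orderRel.le)⟩

/-- The standard interpretation of the language of ordered rings. -/
@[reducible]
def orderedRingStructure (R : Type) [Ring R] [LE R] : orderedRing.Structure R :=
  letI : Language.ring.Structure R := (Ring.compatibleRingOfRing R).toStructure
  letI : Language.order.Structure R := orderStructure R
  Language.sumStructure Language.ring Language.order R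

/-- The interpretation of the symbol `f` by a given function. -/
@[reducible]
def unaryStructure {R : Type} (f : R → R) : unaryLang.Structure R where
  funMap | .f => fun x => f (x 0)
  RelMap R := nomatch R

/-- The standard model of the reals, expanded by a function `f : ℝ → ℝ`. -/
@[reducible]
def realStructure (f : ℝ → ℝ) : orderedRingF.Structure ℝ :=
  letI := orderedRingStructure ℝ
  letI := unaryStructure f
  Language.sumStructure orderedRing unaryLang ℝ

/-- Truth of a formula with free variables `x₀, x₁, …` in `(ℝ, f)` under the assignment `v`. -/
def RealHolds (f : ℝ → ℝ) (φ : orderedRingF.Formula ℕ) (v : ℕ → ℝ) : Prop :=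
  letI := realStructure f
  φ.Realize v

/-- Satisfiability over the standard model of the reals, the symbol `f` being uninterpreted:
some function `f : ℝ → ℝ` and some real values of the free variables make the formula true. -/
def RealSat (φ : orderedRingF.Formula ℕ) : Prop :=
  ∃ (f : ℝ → ℝ) (v : ℕ → ℝ), RealHolds f φ v

/-- Satisfiability of a formula of ordered rings over the integers. -/
def IntSat (φ : orderedRing.Formula ℕ) : Prop :=
  letI := orderedRingStructure ℤ
  ∃ v : ℕ → ℤ, φ.Realize v

/-! ### Gödel numbering -/

/-- The number of a function symbol. -/
def funcCode : {n : ℕ} → orderedRingF.Functions n → ℕ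
  | _, Sum.inl (Sum.inl ringFunc.zero) => 0
  | _, Sum.inl (Sum.inl ringFunc.one) => 1
  | _, Sum.inl (Sum.inl ringFunc.neg) => 2
  | _, Sum.inl (Sum.inl ringFunc.add) => 3
  | _, Sum.inl (Sum.inl ringFunc.mul) => 4
  | _, Sum.inr UnaryFunc.f => 5

/-- The Gödel number of a term with free variables `xᵢ`, `i : ℕ`, and bound variables
indexed by `Fin n`. -/
def termCode {n : ℕ} : orderedRingF.Term (ℕ ⊕ Fin n) → ℕ
  | .var (Sum.inl i) => Nat.pair 0 i
  | .var (Sum.inr i) => Nat.pair 1 i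
  | .func g ts => Nat.pair (funcCode g + 2) (Encodable.encode (List.ofFn fun i => termCode (ts i)))

/-- The Gödel number of a formula (`≤` is the only relation symbol). -/
def formulaCode : {n : ℕ} → orderedRingF.BoundedFormula ℕ n → ℕ
  | _, .falsum => Nat.pair 0 0
  | _, .equal t₁ t₂ => Nat.pair 1 (Nat.pair (termCode t₁) (termCode t₂))
  | _, .rel _ ts => Nat.pair 2 (Encodable.encode (List.ofFn fun i => termCode (ts i)))
  | _, .imp φ ψ => Nat.pair 3 (Nat.pair (formulaCode φ) (formulaCode ψ))
  | _, .all φ => Nat.pair 4 (formulaCode φ)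

theorem funcCode_inj {m n : ℕ} (g : orderedRingF.Functions m) (h : orderedRingF.Functions n)
    (e : funcCode g = funcCode h) : m = n ∧ HEq g h := by
  rcases g with (g | g) | g <;> rcases h with (h | h) | h <;>
    first
    | (cases g; done)
    | (cases h; done)
    | (cases g <;> cases h <;> first | exact ⟨rfl, HEq.rfl⟩ | simp [funcCode] at e)

theorem termCode_injective {n : ℕ} :
    Function.Injective (termCode : orderedRingF.Term (ℕ ⊕ Fin n) → ℕ) := by
  intro s
  induction s with
  | var i =>
    intro t e
    rcases t with (j | j) | ⟨h, us⟩ <;> rcases i with i | i <;>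
      simp [termCode, Nat.pair_eq_pair] at e
    · rw [e]
    · rw [Fin.ext e]
  | func g ts ih =>
    intro t e
    rcases t with (j | j) | ⟨h, us⟩
    · simp [termCode, Nat.pair_eq_pair] at e
    · simp [termCode, Nat.pair_eq_pair] at e
    · simp only [termCode, Nat.pair_eq_pair, Nat.add_right_cancel_iff] at e
      obtain ⟨e₁, e₂⟩ := e
      obtain ⟨rfl, e₁⟩ := funcCode_inj _ _ e₁
      cases e₁
      have e₃ := List.ofFn_injective (Encodable.encode_injective e₂)
      congr 1
      funext i
      exact ih i (congrFun e₃ i)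

theorem formulaCode_injective {n : ℕ} :
    Function.Injective (formulaCode : orderedRingF.BoundedFormula ℕ n → ℕ) := by
  intro φ
  induction φ with
  | falsum =>
    intro ψ e
    cases ψ <;> simp [formulaCode, Nat.pair_eq_pair] at e
    rfl
  | equal t₁ t₂ =>
    intro ψ e
    cases ψ <;> simp [formulaCode, Nat.pair_eq_pair] at e
    rw [termCode_injective e.1, termCode_injective e.2]
  | rel R ts =>
    intro ψ e
    cases ψ with
    | rel S us =>
      rcases R with (R | R) | R <;> rcases S with (S | S) | S <;>
        first
        | (cases R; done)
        | (cases S; done)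
        | skip
      cases R
      cases S
      simp only [formulaCode, Nat.pair_eq_pair, true_and] at e
      have e' := List.ofFn_injective (Encodable.encode_injective e)
      congr 1
      funext i
      exact termCode_injective (congrFun e' i)
    | _ => simp [formulaCode, Nat.pair_eq_pair] at e
  | imp φ₁ φ₂ ih₁ ih₂ =>
    intro ψ e
    cases ψ <;> simp [formulaCode, Nat.pair_eq_pair] at e
    rw [ih₁ e.1, ih₂ e.2]
  | all φ ih =>
    intro ψ e
    cases ψ <;> simp [formulaCode, Nat.pair_eq_pair] at e
    rw [ih e]

/-- A property of formulas is decidable: an algorithm that is given the Gödel number of a formula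
answers whether the formula has the property. -/
def DecidableByAlgorithm (P : orderedRingF.Formula ℕ → Prop) : Prop :=
  ∃ d : ℕ → Bool, Computable d ∧ ∀ φ : orderedRingF.Formula ℕ, d (formulaCode φ) = true ↔ P φ

/-! ### The floor axioms and the translation of integer formulas -/

section
variable {α : Type}

def zeroT : orderedRingF.Term α := Constants.term (L := orderedRingF) (Sum.inl (Sum.inl .zero))

def oneT : orderedRingF.Term α := Constants.term (L := orderedRingF) (Sum.inl (Sum.inl .one))

def addT (s t : orderedRingF.Term α) : orderedRingF.Term α :=
  Functions.apply₂ (L := orderedRingF) (Sum.inl (Sum.inl .add)) s t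

def fT (t : orderedRingF.Term α) : orderedRingF.Term α :=
  Functions.apply₁ (L := orderedRingF) (Sum.inr .f) t

end

/-- The bound variable of an outermost quantifier. -/
def bv : orderedRingF.Term (ℕ ⊕ Fin 1) := Term.var (Sum.inr 0)

/-- The conjunction of `∀ x, f(x) + 1 = f(x + 1)` and `∀ x, 0 ≤ x ∧ x < 1 → f(x) = 0`. -/
def floorAxioms : orderedRingF.Formula ℕ :=
  BoundedFormula.all ((addT (fT bv) oneT).bdEqual (fT (addT bv oneT))) ⊓
  BoundedFormula.all
    ((zeroT.le bv ⊓ bv.lt oneT).imp ((fT bv).bdEqual zeroT))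

/-- The conjunction of the equations `xᵢ = f(xᵢ)` for `i < n`. -/
def integrality : ℕ → orderedRingF.Formula ℕ
  | 0 => ⊤
  | n + 1 => integrality n ⊓ (Term.var n).equal (fT (Term.var n))

/-- A formula of ordered rings, read as a formula of the larger language. -/
def embed (F : orderedRing.Formula ℕ) : orderedRingF.Formula ℕ :=
  (LHom.sumInl : orderedRing →ᴸ orderedRingF).onFormula F

/-- The floor axioms, the equations `xᵢ = f(xᵢ)` for `i < n`, and the formula `F`. -/
def floorTranslation (n : ℕ) (F : orderedRing.Formula ℕ) : orderedRingF.Formula ℕ :=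
  floorAxioms ⊓ integrality n ⊓ embed F

end RealUF

namespace RealUF

/-! ### Semantics of the expanded reals -/

/-! The floor axioms have exactly one model over the reals: the first gives `f (y + k) = f y + k`
for every integer `k`, and writing `x` as fractional part plus floor then yields `f x = ⌊x⌋`. So
conjoining them turns satisfiability over all `f` into a statement about the single structure of the
reals with floor.

Undecidability needs no Diophantine representation, because quantifiers are allowed. In that
structure ℕ is defined by `x = f x ∧ 0 ≤ x`, so quantifiers can be relativised to ℕ and all of
arithmetic is available. Gödel's β function then defines the graph of every partial recursive
function (`natDefinable_of_partrec`). Taking the function that runs program `n` on input 0, one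
fixed formula `φ` defines the halting programs, and `instantiate φ n` has a Gödel number computable
from `n`. A decision procedure would solve the halting problem.

The reduction from ℤ rests on the embedding of ordered rings ℤ → ℝ, which preserves and reflects
quantifier-free formulas (`isQF_realize_intCast`). -/

theorem realStructure_orderedStructure (f : ℝ → ℝ) :
    @OrderedStructure orderedRingF ℝ _ _ (realStructure f) :=
  let _ := realStructure f
  ⟨fun _ => Iff.rfl⟩

/-- Multiplication of terms. -/
def mulT {α : Type} (s t : orderedRingF.Term α) : orderedRingF.Term α :=
  Functions.apply₂ (L := orderedRingF) (Sum.inl (Sum.inl .mul)) s t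

section Realize

variable {α : Type} (f : ℝ → ℝ) (v : α → ℝ) (s t : orderedRingF.Term α)

theorem realize_zeroT : @Term.realize _ _ (realStructure f) _ v zeroT = 0 := rfl

theorem realize_oneT : @Term.realize _ _ (realStructure f) _ v oneT = 1 := rfl

theorem realize_addT :
    @Term.realize _ _ (realStructure f) _ v (addT s t) =
      @Term.realize _ _ (realStructure f) _ v s + @Term.realize _ _ (realStructure f) _ v t := rfl

theorem realize_mulT :
    @Term.realize _ _ (realStructure f) _ v (mulT s t) =
      @Term.realize _ _ (realStructure f) _ v s * @Term.realize _ _ (realStructure f) _ v t := rfl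

theorem realize_fT :
    @Term.realize _ _ (realStructure f) _ v (fT t) =
      f (@Term.realize _ _ (realStructure f) _ v t) := rfl

end Realize

section Holds

variable {f : ℝ → ℝ} {φ ψ : orderedRingF.Formula ℕ} {v : ℕ → ℝ}

theorem realHolds_inf : RealHolds f (φ ⊓ ψ) v ↔ RealHolds f φ v ∧ RealHolds f ψ v := by
  let _ := realStructure f
  exact Formula.realize_inf

theorem realHolds_not : RealHolds f (BoundedFormula.not φ) v ↔ ¬ RealHolds f φ v := by
  let _ := realStructure f
  exact Formula.realize_not

theorem realHolds_top : RealHolds f ⊤ v := by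
  let _ := realStructure f
  exact BoundedFormula.realize_top.2 trivial

theorem realHolds_equal {s t : orderedRingF.Term ℕ} :
    RealHolds f (s.equal t) v ↔
      @Term.realize _ _ (realStructure f) _ v s = @Term.realize _ _ (realStructure f) _ v t := by
  let _ := realStructure f
  exact Formula.realize_equal

theorem realHolds_relabel (σ : ℕ → ℕ) :
    RealHolds f (Formula.relabel σ φ) v ↔ RealHolds f φ (v ∘ σ) := by
  let _ := realStructure f
  exact Formula.realize_relabel

theorem realHolds_floorAxioms :
    RealHolds f floorAxioms v ↔
      (∀ x, f x + 1 = f (x + 1)) ∧ ∀ x, 0 ≤ x ∧ x < 1 → f x = 0 := by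
  let _ := realStructure f
  have := realStructure_orderedStructure f
  simp only [floorAxioms, realHolds_inf]
  refine and_congr ?_ ?_
  · refine BoundedFormula.realize_all.trans (forall_congr' fun x => ?_)
    exact BoundedFormula.realize_bdEqual _ _
  · refine BoundedFormula.realize_all.trans (forall_congr' fun x => ?_)
    refine BoundedFormula.realize_imp.trans (imp_congr ?_ ?_)
    · refine BoundedFormula.realize_inf.trans (and_congr ?_ ?_)
      · exact Term.realize_le
      · exact Term.realize_lt
    · exact BoundedFormula.realize_bdEqual _ _

end Holds

theorem eq_floor_iff (f : ℝ → ℝ) :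
    ((∀ x, f x + 1 = f (x + 1)) ∧ ∀ x, 0 ≤ x ∧ x < 1 → f x = 0) ↔
      ∀ x : ℝ, f x = (⌊x⌋ : ℝ) := by
  constructor
  · rintro ⟨hs, h0⟩ x
    have shift : ∀ (k : ℤ) (y : ℝ), f (y + k) = f y + k := by
      intro k
      induction k with
      | zero => simp
      | succ n ih =>
        intro y
        have := hs (y + (n : ℤ))
        rw [ih] at this
        push_cast at this ⊢
        rw [← add_assoc, ← this, add_assoc]
      | pred n ih =>
        intro y
        have := hs (y + ((-n - 1 : ℤ) : ℝ))
        have e : y + ((-n - 1 : ℤ) : ℝ) + 1 = y + ((-n : ℤ) : ℝ) := by push_cast; ring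
        rw [e, ih] at this
        push_cast at this ⊢
        linarith
    have := shift ⌊x⌋ (Int.fract x)
    rwa [Int.fract_add_floor, h0 _ ⟨Int.fract_nonneg x, Int.fract_lt_one x⟩, zero_add] at this
  · intro h
    refine ⟨fun x => by simp [h], fun x hx => ?_⟩
    rw [h, Int.floor_eq_zero_iff.2 hx, Int.cast_zero]

theorem realHolds_floorAxioms_iff (f : ℝ → ℝ) (v : ℕ → ℝ) :
    RealHolds f floorAxioms v ↔ ∀ x : ℝ, f x = (⌊x⌋ : ℝ) :=
  realHolds_floorAxioms.trans (eq_floor_iff f)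

theorem realHolds_integrality (n : ℕ) (v : ℕ → ℝ) :
    RealHolds (fun x : ℝ => (⌊x⌋ : ℝ)) (integrality n) v ↔ ∀ i < n, ∃ k : ℤ, v i = k := by
  induction n with
  | zero => simp [integrality, realHolds_top]
  | succ n ih =>
    rw [integrality, realHolds_inf, ih, realHolds_equal, realize_fT, Nat.forall_lt_succ_right]
    refine and_congr_right fun _ => ⟨fun h => ⟨_, h⟩, ?_⟩
    rintro ⟨k, hk⟩
    simp [Term.realize, hk]

/-! ### Quantifier-free formulas over the integers and over the reals -/

theorem realHolds_embed (f : ℝ → ℝ) (F : orderedRing.Formula ℕ) (v : ℕ → ℝ) :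
    RealHolds f (embed F) v ↔ @Formula.Realize _ _ (orderedRingStructure ℝ) _ F v := by
  let _ := orderedRingStructure ℝ
  let _ := unaryStructure f
  exact LHom.realize_onBoundedFormula (LHom.sumInl : orderedRing →ᴸ orderedRingF) F

theorem realize_intCast {α : Type} (t : orderedRing.Term α) (v : α → ℤ) :
    @Term.realize _ _ (orderedRingStructure ℝ) _ (fun i => (v i : ℝ)) t =
      (@Term.realize _ _ (orderedRingStructure ℤ) _ v t : ℤ) := by
  induction t with
  | var i => rfl
  | func g ts ih =>
    rcases g with g | g
    · cases g with
      | add => exact (congrArg₂ (· + ·) (ih 0) (ih 1)).trans (Int.cast_add _ _).symm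
      | mul => exact (congrArg₂ (· * ·) (ih 0) (ih 1)).trans (Int.cast_mul _ _).symm
      | neg => exact (congrArg Neg.neg (ih 0)).trans (Int.cast_neg _).symm
      | zero => exact Int.cast_zero.symm
      | one => exact Int.cast_one.symm
    · cases g

/-- The cast is injective, strictly monotone and a ring homomorphism, so atomic formulas agree on
both sides and implications follow. A quantifier would range over different domains. -/
theorem isQF_realize_intCast {n : ℕ} {F : orderedRing.BoundedFormula ℕ n} (hF : F.IsQF)
    (v : ℕ → ℤ) (xs : Fin n → ℤ) :
    @BoundedFormula.Realize _ _ (orderedRingStructure ℝ) _ _ F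
        (fun i => (v i : ℝ)) (fun i => (xs i : ℝ)) ↔
      @BoundedFormula.Realize _ _ (orderedRingStructure ℤ) _ _ F v xs := by
  have cast_elim : Sum.elim (fun i => (v i : ℝ)) (fun i => (xs i : ℝ)) =
      fun i => ((Sum.elim v xs i : ℤ) : ℝ) := by
    ext (i | i) <;> rfl
  induction hF with
  | falsum => exact Iff.rfl
  | of_isAtomic h =>
    cases h with
    | equal s t =>
      simp only [BoundedFormula.realize_bdEqual, cast_elim, realize_intCast, Int.cast_inj]
    | rel R ts =>
      rcases R with R | R
      · cases R
      · cases R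
        have e (i) := (congrArg (fun u => @Term.realize _ _ (orderedRingStructure ℝ) _ u (ts i))
          cast_elim).trans (realize_intCast (ts i) (Sum.elim v xs))
        exact (iff_of_eq (congrArg₂ (· ≤ ·) (e 0) (e 1))).trans Int.cast_le
  | imp _ _ ih₁ ih₂ => exact imp_congr ih₁ ih₂

theorem formula_realize_iff {L : Language} {M : Type} [L.Structure M] {α : Type} {F : L.Formula α}
    {v : α → M} {xs : Fin 0 → M} : F.Realize v ↔ BoundedFormula.Realize F v xs := by
  rw [Formula.Realize, Subsingleton.elim xs default]

/-- Both sides are equivalent to the same restricted formula, whose variables are only the free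
variables of `F`, evaluated at `v`. -/
theorem formula_realize_congr {L : Language} {M : Type} [L.Structure M] {F : L.Formula ℕ}
    {v w : ℕ → M} (h : ∀ i ∈ F.freeVarFinset, v i = w i) : F.Realize v ↔ F.Realize w := by
  have hv := BoundedFormula.realize_restrictFreeVar (φ := F) (f := fun a => (a : ℕ)) (v := v)
    (xs := default) v fun _ => rfl
  have hw := BoundedFormula.realize_restrictFreeVar (φ := F) (f := fun a => (a : ℕ)) (v := v)
    (xs := default) w fun a => h a a.2
  exact hv.symm.trans hw

theorem intSat_iff_realSat_floorTranslation (n : ℕ) (F : orderedRing.Formula ℕ)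
    (hF : BoundedFormula.IsQF F) (hn : F.freeVarFinset ⊆ Finset.range n) :
    IntSat F ↔ RealSat (floorTranslation n F) := by
  have cast_iff (w : ℕ → ℤ) :
      @Formula.Realize _ _ (orderedRingStructure ℝ) _ F (fun i => (w i : ℝ)) ↔
        @Formula.Realize _ _ (orderedRingStructure ℤ) _ F w := by
    refine Iff.trans ?_ ((isQF_realize_intCast hF w default).trans ?_)
    · exact @formula_realize_iff _ _ (orderedRingStructure ℝ) _ _ _ _
    · exact (@formula_realize_iff _ _ (orderedRingStructure ℤ) _ _ _ _).symm
  constructor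
  · rintro ⟨w, hw⟩
    refine ⟨fun x => (⌊x⌋ : ℝ), fun i => (w i : ℝ), ?_⟩
    rw [floorTranslation, realHolds_inf, realHolds_inf, realHolds_floorAxioms_iff,
      realHolds_integrality, realHolds_embed, cast_iff]
    exact ⟨⟨fun _ => rfl, fun i _ => ⟨w i, rfl⟩⟩, hw⟩
  · rintro ⟨f, v, h⟩
    rw [floorTranslation, realHolds_inf, realHolds_inf, realHolds_floorAxioms_iff] at h
    obtain ⟨⟨hf, hi⟩, hF'⟩ := h
    obtain rfl : f = fun x => (⌊x⌋ : ℝ) := funext hf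
    rw [realHolds_integrality] at hi
    rw [realHolds_embed] at hF'
    -- For `i ≥ n` the real `v i` is arbitrary; the floor supplies some integer there, which `F`
    -- does not see.
    refine ⟨fun i => ⌊v i⌋, (cast_iff _).1 ?_⟩
    let _ := orderedRingStructure ℝ
    refine (formula_realize_congr fun i hi' => ?_).1 hF'
    obtain ⟨k, hk⟩ := hi i (Finset.mem_range.1 (hn hi'))
    simp [hk]

/-! ### Arithmetical relations definable in the reals with the floor function -/

/-- A relation between natural numbers `x₀, x₁, …` is defined, on natural number arguments, by a
formula in the reals with the floor function. -/
def NatDefinable (P : (ℕ → ℕ) → Prop) : Prop :=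
  ∃ φ : orderedRingF.Formula ℕ, ∀ w : ℕ → ℕ,
    RealHolds (fun x : ℝ => (⌊x⌋ : ℝ)) φ (fun i => (w i : ℝ)) ↔ P w

/-- The graph of a function of natural numbers `x₀, x₁, …` is definable. -/
def NatDefinableFun (F : (ℕ → ℕ) → ℕ) : Prop :=
  NatDefinable fun w => w 0 = F fun i => w (i + 1)

/-- De Bruijn convention for all that follows: variable 0 becomes the bound one and variable `i + 1`
becomes `i`. -/
theorem exists_realHolds_iff_exists (f : ℝ → ℝ) (φ : orderedRingF.Formula ℕ) :
    ∃ ψ : orderedRingF.Formula ℕ, ∀ v : ℕ → ℝ,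
      RealHolds f ψ v ↔ ∃ x : ℝ, RealHolds f φ (fun i => Nat.casesOn i x v) := by
  let _ := realStructure f
  refine ⟨(BoundedFormula.relabel (n := 1) (k := 0)
    (fun i => Nat.casesOn i (Sum.inr 0) Sum.inl : ℕ → ℕ ⊕ Fin 1) φ).ex, fun v => ?_⟩
  refine BoundedFormula.realize_ex.trans (exists_congr fun x => ?_)
  refine BoundedFormula.realize_relabel.trans ?_
  unfold RealHolds Formula.Realize
  refine iff_of_eq (congrArg₂ _ ?_ (Subsingleton.elim _ _))
  ext i
  cases i <;> rfl

theorem exists_realHolds_iff_natCast :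
    ∃ ψ : orderedRingF.Formula ℕ, ∀ v : ℕ → ℝ,
      RealHolds (fun x : ℝ => (⌊x⌋ : ℝ)) ψ v ↔ ∃ k : ℕ, v 0 = k := by
  let _ := realStructure fun x : ℝ => (⌊x⌋ : ℝ)
  have := realStructure_orderedStructure fun x : ℝ => (⌊x⌋ : ℝ)
  refine ⟨(Term.var 0).equal (fT (Term.var 0)) ⊓
    Term.le (α := ℕ) (n := 0) zeroT (Term.var (Sum.inl 0)), fun v => ?_⟩
  rw [realHolds_inf, realHolds_equal, realize_fT]
  refine Iff.trans (and_congr_right' Term.realize_le) ?_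
  change v 0 = (⌊v 0⌋ : ℝ) ∧ 0 ≤ v 0 ↔ _
  constructor
  · rintro ⟨h, h0⟩
    obtain ⟨k, hk⟩ := Int.eq_ofNat_of_zero_le (Int.floor_nonneg.2 h0)
    exact ⟨k, by rw [h, hk]; simp⟩
  · rintro ⟨k, hk⟩
    simp [hk]

/-! ### Closure of definable relations under connectives, quantifiers over ℕ and substitution. -/

namespace NatDefinable

variable {P Q : (ℕ → ℕ) → Prop}

theorem of_iff (h : NatDefinable P) (e : ∀ w, P w ↔ Q w) : NatDefinable Q :=
  h.imp fun _ hφ w => (hφ w).trans (e w)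

theorem and (hP : NatDefinable P) (hQ : NatDefinable Q) : NatDefinable fun w => P w ∧ Q w := by
  obtain ⟨φ, hφ⟩ := hP
  obtain ⟨ψ, hψ⟩ := hQ
  exact ⟨φ ⊓ ψ, fun w => realHolds_inf.trans (and_congr (hφ w) (hψ w))⟩

theorem not (hP : NatDefinable P) : NatDefinable fun w => ¬ P w := by
  obtain ⟨φ, hφ⟩ := hP
  exact ⟨BoundedFormula.not φ, fun w => realHolds_not.trans (not_congr (hφ w))⟩

theorem or (hP : NatDefinable P) (hQ : NatDefinable Q) : NatDefinable fun w => P w ∨ Q w :=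
  (hP.not.and hQ.not).not.of_iff fun w => by tauto

theorem imp (hP : NatDefinable P) (hQ : NatDefinable Q) : NatDefinable fun w => P w → Q w :=
  (hP.and hQ.not).not.of_iff fun w => by tauto

theorem relabel (σ : ℕ → ℕ) (hP : NatDefinable P) : NatDefinable fun w => P fun i => w (σ i) := by
  obtain ⟨φ, hφ⟩ := hP
  exact ⟨Formula.relabel σ φ, fun w => (realHolds_relabel σ).trans (hφ fun i => w (σ i))⟩

theorem exists' {P : ℕ → (ℕ → ℕ) → Prop} (hP : NatDefinable fun w => P (w 0) fun i => w (i + 1)) :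
    NatDefinable fun w => ∃ x, P x w := by
  obtain ⟨φ, hφ⟩ := hP
  obtain ⟨ν, hν⟩ := exists_realHolds_iff_natCast
  obtain ⟨ψ, hψ⟩ := exists_realHolds_iff_exists (fun x : ℝ => (⌊x⌋ : ℝ)) (ν ⊓ φ)
  refine ⟨ψ, fun w => (hψ _).trans ?_⟩
  have key (k : ℕ) : RealHolds (fun x : ℝ => (⌊x⌋ : ℝ)) φ
      (fun i => Nat.casesOn i (k : ℝ) fun i => (w i : ℝ)) ↔ P k w := by
    refine Iff.trans ?_ (hφ fun i => Nat.casesOn i k w)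
    refine iff_of_eq (congrArg _ (funext fun i => ?_))
    cases i <;> rfl
  constructor
  · rintro ⟨x, hx⟩
    rw [realHolds_inf, hν] at hx
    obtain ⟨⟨k, hk⟩, h⟩ := hx
    obtain rfl : x = k := hk
    exact ⟨k, (key k).1 h⟩
  · rintro ⟨k, hk⟩
    exact ⟨k, realHolds_inf.2 ⟨(hν _).2 ⟨k, rfl⟩, (key k).2 hk⟩⟩

theorem forall' {P : ℕ → (ℕ → ℕ) → Prop} (hP : NatDefinable fun w => P (w 0) fun i => w (i + 1)) :
    NatDefinable fun w => ∀ x, P x w :=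
  (exists' (P := fun x w => ¬ P x w) hP.not).not.of_iff fun w => by simp

theorem subst {P : ℕ → (ℕ → ℕ) → Prop} {F : (ℕ → ℕ) → ℕ}
    (hP : NatDefinable fun w => P (w 0) fun i => w (i + 1)) (hF : NatDefinableFun F) :
    NatDefinable fun w => P (F w) w :=
  (exists' (P := fun x w => x = F w ∧ P x w) (hF.and hP)).of_iff fun w => by simp

theorem subst₂ {R : ℕ → ℕ → Prop} {F G : (ℕ → ℕ) → ℕ}
    (hR : NatDefinable fun w => R (w 0) (w 1)) (hF : NatDefinableFun F) (hG : NatDefinableFun G) :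
    NatDefinable fun w => R (F w) (G w) := by
  refine subst (P := fun x w => R x (G w)) ?_ hF
  refine subst (P := fun y w => R (w 0) y) ?_ (F := fun w => G fun i => w (i + 1)) ?_
  -- Under both substitutions index 0 holds the value of `G` and index 1 that of `F`, so the
  -- arguments of `R` are swapped.
  · exact hR.relabel fun i => Nat.casesOn i 1 fun _ => 0
  · exact NatDefinable.relabel (fun i => Nat.casesOn i 0 fun j => j + 2) hG

end NatDefinable

/-! ### Definable functions, up to Gödel's β function. -/

namespace NatDefinableFun

variable {F G : (ℕ → ℕ) → ℕ}

theorem relabel (σ : ℕ → ℕ) (hF : NatDefinableFun F) :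
    NatDefinableFun fun w => F fun i => w (σ i) := by
  exact NatDefinable.relabel (fun i => Nat.casesOn i 0 fun j => σ j + 1) hF

theorem of_graph {f : ℕ → ℕ} (h : NatDefinable fun w => w 1 = f (w 0)) (hF : NatDefinableFun F) :
    NatDefinableFun fun w => f (F w) :=
  NatDefinable.subst (P := fun x w => w 0 = f x) (F := fun w => F fun i => w (i + 1))
    (h.relabel fun i => i)
    (hF.relabel fun i => i + 1)

theorem of_graph₂ {f : ℕ → ℕ → ℕ} (h : NatDefinable fun w => w 0 = f (w 1) (w 2))
    (hF : NatDefinableFun F) (hG : NatDefinableFun G) :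
    NatDefinableFun fun w => f (F w) (G w) := by
  refine NatDefinable.subst (P := fun x w => w 0 = f x (G fun i => w (i + 1)))
    (F := fun w => F fun i => w (i + 1)) ?_ (hF.relabel fun i => i + 1)
  refine NatDefinable.subst (P := fun y w => w 1 = f (w 0) y)
    (F := fun w => G fun i => w (i + 2)) ?_ (hG.relabel fun i => i + 2)
  exact h.relabel fun i => Nat.casesOn i 2 fun j => Nat.casesOn j 1 fun _ => 0

theorem proj (i : ℕ) : NatDefinableFun fun w => w i :=
  ⟨(Term.var 0).equal (Term.var (i + 1)), fun w => by
    rw [realHolds_equal]; exact Nat.cast_inj⟩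

theorem const (k : ℕ) : NatDefinableFun fun _ => k := by
  induction k with
  | zero =>
    exact ⟨(Term.var 0).equal zeroT, fun w => by
      rw [realHolds_equal, realize_zeroT]; exact Nat.cast_eq_zero⟩
  | succ k ih =>
    refine of_graph (f := Nat.succ) ?_ ih
    refine ⟨(Term.var 1).equal (addT (Term.var 0) oneT), fun w => ?_⟩
    rw [realHolds_equal, realize_addT, realize_oneT]
    change (w 1 : ℝ) = w 0 + 1 ↔ _
    norm_cast

theorem add (hF : NatDefinableFun F) (hG : NatDefinableFun G) :
    NatDefinableFun fun w => F w + G w := by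
  refine of_graph₂ ⟨(Term.var 0).equal (addT (Term.var 1) (Term.var 2)), fun w => ?_⟩ hF hG
  rw [realHolds_equal, realize_addT]
  change (w 0 : ℝ) = w 1 + w 2 ↔ _
  norm_cast

theorem mul (hF : NatDefinableFun F) (hG : NatDefinableFun G) :
    NatDefinableFun fun w => F w * G w := by
  refine of_graph₂ ⟨(Term.var 0).equal (mulT (Term.var 1) (Term.var 2)), fun w => ?_⟩ hF hG
  rw [realHolds_equal, realize_mulT]
  change (w 0 : ℝ) = w 1 * w 2 ↔ _
  norm_cast

theorem eq (hF : NatDefinableFun F) (hG : NatDefinableFun G) :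
    NatDefinable fun w => F w = G w :=
  NatDefinable.subst₂ (proj 0) hF hG

theorem lt (hF : NatDefinableFun F) (hG : NatDefinableFun G) :
    NatDefinable fun w => F w < G w := by
  have h : NatDefinable fun w => w 0 < w 1 :=
    (NatDefinable.exists' (P := fun k w => w 1 = w 0 + k + 1)
      (((proj 2).eq (((proj 1).add (proj 0)).add (const 1))))).of_iff fun w =>
      ⟨by rintro ⟨k, hk⟩; omega, fun h => ⟨w 1 - w 0 - 1, by omega⟩⟩
  exact NatDefinable.subst₂ h hF hG

theorem pair (hF : NatDefinableFun F) (hG : NatDefinableFun G) :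
    NatDefinableFun fun w => Nat.pair (F w) (G w) := by
  refine of_graph₂ ?_ hF hG
  refine ((((proj 1).lt (proj 2)).and ((proj 0).eq (((proj 2).mul (proj 2)).add (proj 1)))).or
    (((proj 1).lt (proj 2)).not.and
      ((proj 0).eq ((((proj 1).mul (proj 1)).add (proj 1)).add (proj 2))))).of_iff fun w => ?_
  unfold Nat.pair
  split_ifs with h <;> simp [h]

theorem unpair_fst (hF : NatDefinableFun F) : NatDefinableFun fun w => (F w).unpair.1 := by
  refine of_graph (f := fun n => n.unpair.1) ?_ hF
  refine (NatDefinable.exists' (P := fun b w => w 0 = Nat.pair (w 1) b)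
    ((proj 1).eq ((proj 2).pair (proj 0)))).of_iff fun w => ⟨?_, fun h => ⟨(w 0).unpair.2, ?_⟩⟩
  · rintro ⟨b, hb⟩
    simp [hb]
  · rw [h, Nat.pair_unpair]

theorem unpair_snd (hF : NatDefinableFun F) : NatDefinableFun fun w => (F w).unpair.2 := by
  refine of_graph (f := fun n => n.unpair.2) ?_ hF
  refine (NatDefinable.exists' (P := fun a w => w 0 = Nat.pair a (w 1))
    ((proj 1).eq ((proj 0).pair (proj 2)))).of_iff fun w => ⟨?_, fun h => ⟨(w 0).unpair.1, ?_⟩⟩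
  · rintro ⟨b, hb⟩
    simp [hb]
  · rw [h, Nat.pair_unpair]

/-- The modulus has the successor form occurring in `Nat.beta`; being positive, it lets the
remainder be characterised by its bound and a quotient. -/
theorem mod_succ (hF : NatDefinableFun F) (hG : NatDefinableFun G) :
    NatDefinableFun fun w => F w % (G w + 1) := by
  refine of_graph₂ (f := fun a b => a % (b + 1)) ?_ hF hG
  refine (((proj 0).lt ((proj 2).add (const 1))).and
    (NatDefinable.exists' (P := fun q w => w 1 = w 0 + (w 2 + 1) * q)
      ((proj 2).eq ((proj 1).add (((proj 3).add (const 1)).mul (proj 0)))))).of_iff fun w => ⟨?_, ?_⟩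
  · rintro ⟨h, q, hq⟩
    rw [hq, Nat.add_mul_mod_self_left, Nat.mod_eq_of_lt h]
  · intro h
    exact ⟨h ▸ Nat.mod_lt _ (Nat.succ_pos _), w 1 / (w 2 + 1), by rw [h, Nat.mod_add_div]⟩

theorem beta (hF : NatDefinableFun F) (hG : NatDefinableFun G) :
    NatDefinableFun fun w => Nat.beta (F w) (G w) :=
  hF.unpair_fst.mod_succ ((hG.add (const 1)).mul hF.unpair_snd)

end NatDefinableFun

/-! ### Definability of partial recursive functions -/

theorem exists_beta_eq (n : ℕ) (s : ℕ → ℕ) : ∃ c, ∀ i ≤ n, Nat.beta c i = s i := by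
  refine ⟨Nat.unbeta (List.ofFn fun i : Fin (n + 1) => s i), fun i hi => ?_⟩
  have := Nat.beta_unbeta_coe (List.ofFn fun i : Fin (n + 1) => s i)
    ⟨i, by simpa using Nat.lt_succ_of_le hi⟩
  simpa only [Fin.getElem_fin, List.getElem_ofFn] using this

/-- The recursion converges to `b` exactly when a finite history of intermediate values ends in `b`;
the number `c` codes that history, so recursion becomes a first-order statement. -/
theorem mem_rec_iff_exists_beta (p : Part ℕ) (g : ℕ → ℕ → Part ℕ) (n b : ℕ) :
    b ∈ (Nat.rec p (fun y IH => IH >>= g y) n : Part ℕ) ↔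
      ∃ c, Nat.beta c 0 ∈ p ∧ (∀ i < n, Nat.beta c (i + 1) ∈ g i (Nat.beta c i)) ∧
        Nat.beta c n = b := by
  have of_seq : ∀ (n : ℕ) (s : ℕ → ℕ), s 0 ∈ p → (∀ i < n, s (i + 1) ∈ g i (s i)) →
      s n ∈ (Nat.rec p (fun y IH => IH >>= g y) n : Part ℕ) := by
    intro n s h0 hs
    induction n with
    | zero => exact h0
    | succ n ih =>
      exact Part.mem_bind_iff.2 ⟨s n, ih fun i hi => hs i (by omega), hs n (by omega)⟩
  have to_seq : ∀ (n b : ℕ), b ∈ (Nat.rec p (fun y IH => IH >>= g y) n : Part ℕ) →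
      ∃ s : ℕ → ℕ, s 0 ∈ p ∧ (∀ i < n, s (i + 1) ∈ g i (s i)) ∧ s n = b := by
    intro n
    induction n with
    | zero => exact fun b hb => ⟨fun _ => b, hb, by simp, rfl⟩
    | succ n ih =>
      intro b hb
      obtain ⟨a, ha, hab⟩ := Part.mem_bind_iff.1 hb
      obtain ⟨s, h0, hs, hn⟩ := ih a ha
      refine ⟨fun i => if i ≤ n then s i else b, by simpa using h0, fun i hi => ?_, by simp⟩
      rcases Nat.lt_succ_iff_lt_or_eq.1 hi with h | rfl
      · simpa [h.le, Nat.succ_le_of_lt h] using hs i h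
      · simpa [hn] using hab
  constructor
  · intro hb
    obtain ⟨s, h0, hs, hn⟩ := to_seq n b hb
    obtain ⟨c, hc⟩ := exists_beta_eq n s
    refine ⟨c, by rwa [hc 0 (by omega)], fun i hi => ?_, by rwa [hc n le_rfl]⟩
    rw [hc i hi.le, hc (i + 1) hi]
    exact hs i hi
  · rintro ⟨c, h0, hs, rfl⟩
    exact of_seq n (Nat.beta c) h0 hs

open NatDefinableFun in
-- Induction on the construction of `g`; only primitive recursion needs β, the other cases being
-- direct uses of the closure properties.
theorem natDefinable_of_partrec {g : ℕ →. ℕ} (hg : Nat.Partrec g) :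
    NatDefinable fun w => w 1 ∈ g (w 0) := by
  induction hg with
  | zero =>
    refine ((proj 1).eq (const 0)).of_iff fun w => ?_
    exact Part.mem_some_iff.symm
  | succ =>
    refine ((proj 1).eq ((proj 0).add (const 1))).of_iff fun w => ?_
    exact Part.mem_some_iff.symm
  | left =>
    refine ((proj 1).eq (proj 0).unpair_fst).of_iff fun w => ?_
    exact Part.mem_some_iff.symm
  | right =>
    refine ((proj 1).eq (proj 0).unpair_snd).of_iff fun w => ?_
    exact Part.mem_some_iff.symm
  | @pair f g _ _ hf hg =>
    refine (NatDefinable.exists' (P := fun a w => ∃ b, a ∈ f (w 0) ∧ b ∈ g (w 0) ∧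
      w 1 = Nat.pair a b) ?_).of_iff fun w => ?_
    · refine NatDefinable.exists' ?_
      exact (NatDefinable.subst₂ (R := fun x y => y ∈ f x) hf (proj 2) (proj 1)).and
        ((NatDefinable.subst₂ (R := fun x y => y ∈ g x) hg (proj 2) (proj 0)).and
          ((proj 3).eq ((proj 1).pair (proj 0))))
    · simp only [Seq.seq, Part.mem_bind_iff, Part.map_eq_map, Part.mem_map_iff]
      constructor
      · rintro ⟨a, b, ha, hb, h⟩
        exact ⟨_, ⟨a, ha, rfl⟩, b, hb, h.symm⟩
      · rintro ⟨_, ⟨a, ha, rfl⟩, b, hb, h⟩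
        exact ⟨a, b, ha, hb, h.symm⟩
  | @comp f g _ _ hf hg =>
    refine (NatDefinable.exists' (P := fun a w => a ∈ g (w 0) ∧ w 1 ∈ f a) ?_).of_iff fun w => ?_
    · exact (NatDefinable.subst₂ (R := fun x y => y ∈ g x) hg (proj 1) (proj 0)).and
        (NatDefinable.subst₂ (R := fun x y => y ∈ f x) hf (proj 0) (proj 2))
    · exact Part.mem_bind_iff.symm
  | @prec f g _ _ hf hg =>
    refine (NatDefinable.exists' (P := fun c w => Nat.beta c 0 ∈ f (w 0).unpair.1 ∧
      (∀ i, i < (w 0).unpair.2 → Nat.beta c (i + 1) ∈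
        g (Nat.pair (w 0).unpair.1 (Nat.pair i (Nat.beta c i)))) ∧
      Nat.beta c (w 0).unpair.2 = w 1) ?_).of_iff fun w => ?_
    · refine (NatDefinable.subst₂ (R := fun x y => y ∈ f x) hf (proj 1).unpair_fst
        ((proj 0).beta (const 0))).and (NatDefinable.and ?_
        (((proj 0).beta (proj 1).unpair_snd).eq (proj 2)))
      refine NatDefinable.forall' (((proj 0).lt (proj 2).unpair_snd).imp ?_)
      exact NatDefinable.subst₂ (R := fun x y => y ∈ g x) hg
        ((proj 2).unpair_fst.pair ((proj 0).pair ((proj 1).beta (proj 0))))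
        ((proj 1).beta ((proj 0).add (const 1)))
    · exact (mem_rec_iff_exists_beta (f (w 0).unpair.1)
        (fun y i => g (Nat.pair (w 0).unpair.1 (Nat.pair y i))) (w 0).unpair.2 (w 1)).symm
  | @rfind f _ hf =>
    -- Unbounded search requires every earlier value to be defined as well as nonzero, hence the
    -- witness `y`.
    refine (NatDefinable.and (P := fun w => 0 ∈ f (Nat.pair (w 0) (w 1)))
      (Q := fun w => ∀ k, k < w 1 → ∃ y, y ∈ f (Nat.pair (w 0) k) ∧ ¬ y = 0) ?_ ?_).of_iff
        fun w => ?_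
    · exact NatDefinable.subst₂ (R := fun x y => y ∈ f x) hf ((proj 0).pair (proj 1)) (const 0)
    · refine NatDefinable.forall' (((proj 0).lt (proj 2)).imp (NatDefinable.exists' ?_))
      exact (NatDefinable.subst₂ (R := fun x y => y ∈ f x) hf ((proj 2).pair (proj 1)) (proj 0)).and
        ((proj 0).eq (const 0)).not
    · refine Iff.trans ?_ Nat.mem_rfind.symm
      simp [Part.mem_map_iff]

/-! ### Computability on Gödel numbers -/

/-- The Gödel number of a conjunction, computed from those of the conjuncts. -/
def infCode (a b : ℕ) : ℕ :=
  Nat.pair 3 (Nat.pair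
    (Nat.pair 3 (Nat.pair a (Nat.pair 3 (Nat.pair b (Nat.pair 0 0))))) (Nat.pair 0 0))

/-- Definitional, since `φ ⊓ ψ` unfolds to `(φ → (ψ → ⊥)) → ⊥`. -/
theorem formulaCode_inf {n : ℕ} (φ ψ : orderedRingF.BoundedFormula ℕ n) :
    formulaCode (φ ⊓ ψ) = infCode (formulaCode φ) (formulaCode ψ) := rfl

theorem primrec_infCode : Primrec₂ infCode := by
  have pair3 {f : ℕ × ℕ → ℕ} (hf : Primrec f) : Primrec fun p => Nat.pair 3 (f p) :=
    Primrec₂.natPair.comp (.const 3) hf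
  exact pair3 (Primrec₂.natPair.comp (pair3 (Primrec₂.natPair.comp .fst
    (pair3 (Primrec₂.natPair.comp .snd (.const _))))) (.const _))

theorem formulaCode_equal (s t : orderedRingF.Term ℕ) :
    formulaCode (s.equal t) = Nat.pair 1 (Nat.pair
      (termCode (s.relabel (Sum.inl : ℕ → ℕ ⊕ Fin 0)))
      (termCode (t.relabel (Sum.inl : ℕ → ℕ ⊕ Fin 0)))) := rfl

/-- Here 7 is the code 5 of `f` shifted by 2, and `Nat.pair _ 0 + 1` encodes a one-element list. -/
theorem formulaCode_integrality_succ (n : ℕ) :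
    formulaCode (integrality (n + 1)) = infCode (formulaCode (integrality n))
      (Nat.pair 1 (Nat.pair (Nat.pair 0 n) (Nat.pair 7 (Nat.pair (Nat.pair 0 n) 0 + 1)))) := by
  rw [integrality, formulaCode_inf, formulaCode_equal]
  simp [fT, Functions.apply₁, Term.relabel, termCode, funcCode]

theorem primrec_formulaCode_integrality : Primrec fun n => formulaCode (integrality n) := by
  refine (Primrec.nat_rec₁ (formulaCode (integrality 0)) (f := fun n a => infCode a
    (Nat.pair 1 (Nat.pair (Nat.pair 0 n) (Nat.pair 7 (Nat.pair (Nat.pair 0 n) 0 + 1))))) ?_).of_eq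
    fun n => ?_
  · have hv : Primrec fun p : ℕ × ℕ => Nat.pair 0 p.1 := Primrec₂.natPair.comp (.const 0) .fst
    exact primrec_infCode.comp .snd (Primrec₂.natPair.comp (.const 1) (Primrec₂.natPair.comp hv
      (Primrec₂.natPair.comp (.const 7) (Primrec.succ.comp
        (Primrec₂.natPair.comp hv (.const 0))))))
  · induction n with
    | zero => rfl
    | succ n ih => rw [formulaCode_integrality_succ, ← ih]

theorem exists_computable_formulaCode_floorTranslation :
    ∃ T : ℕ × ℕ → ℕ, Computable T ∧ ∀ (n : ℕ) (F : orderedRing.Formula ℕ),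
      T (n, formulaCode (embed F)) = formulaCode (floorTranslation n F) := by
  refine ⟨fun p => infCode (infCode (formulaCode floorAxioms) (formulaCode (integrality p.1))) p.2,
    Primrec.to_comp ?_, fun n F => rfl⟩
  exact primrec_infCode.comp (primrec_infCode.comp (.const _)
    (primrec_formulaCode_integrality.comp .fst)) .snd

/-- The numeral `0 + 1 + ⋯ + 1`. -/
def numeral {α : Type} : ℕ → orderedRingF.Term α
  | 0 => zeroT
  | n + 1 => addT (numeral n) oneT

theorem realize_numeral {α : Type} (f : ℝ → ℝ) (v : α → ℝ) (n : ℕ) :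
    @Term.realize _ _ (realStructure f) _ v (numeral n) = n := by
  induction n with
  | zero => rw [numeral, realize_zeroT, Nat.cast_zero]
  | succ n ih => rw [numeral, realize_addT, ih, realize_oneT, Nat.cast_succ]

theorem relabel_numeral {α β : Type} (σ : α → β) (n : ℕ) :
    (numeral n).relabel σ = numeral n := by
  have h0 : (zeroT : orderedRingF.Term α).relabel σ = zeroT :=
    congrArg (Term.func _) (Subsingleton.elim _ _)
  have h1 : (oneT : orderedRingF.Term α).relabel σ = oneT :=
    congrArg (Term.func _) (Subsingleton.elim _ _)
  induction n with
  | zero => exact h0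
  | succ n ih =>
    rw [numeral, numeral]
    conv_rhs => rw [← ih, ← h1]
    refine congrArg (Term.func _) (funext fun i => ?_)
    fin_cases i <;> rfl

theorem primrec_termCode_numeral {k : ℕ} :
    Primrec fun n => termCode (numeral n : orderedRingF.Term (ℕ ⊕ Fin k)) := by
  refine (Primrec.nat_rec₁ (termCode (zeroT : orderedRingF.Term (ℕ ⊕ Fin k)))
    -- The code 3 of addition shifted by 2, followed by the encoding of a two-element list.
    (f := fun _ a => Nat.pair 5
      (Nat.pair a (Nat.pair (termCode (oneT : orderedRingF.Term (ℕ ⊕ Fin k))) 0 + 1) + 1))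
    ?_).of_eq fun n => ?_
  · exact Primrec₂.natPair.comp (.const 5)
      (Primrec.succ.comp (Primrec₂.natPair.comp .snd (.const _)))
  · induction n with
    | zero => rfl
    | succ n ih =>
      rw [numeral]
      simp [addT, Functions.apply₂, termCode, funcCode, ih]

/-! ### Undecidability -/

/-- The floor axioms, the formula `φ` with all its free variables replaced by `x₀`, and the equation
`x₀ = n`. -/
def instantiate (φ : orderedRingF.Formula ℕ) (n : ℕ) : orderedRingF.Formula ℕ :=
  floorAxioms ⊓ Formula.relabel (fun _ => 0) φ ⊓ (Term.var 0).equal (numeral n)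

theorem primrec_formulaCode_instantiate (φ : orderedRingF.Formula ℕ) :
    Primrec fun n => formulaCode (instantiate φ n) := by
  have h : Primrec fun n => Nat.pair 1 (Nat.pair (Nat.pair 0 0)
      (termCode (numeral n : orderedRingF.Term (ℕ ⊕ Fin 0)))) :=
    Primrec₂.natPair.comp (.const 1) (Primrec₂.natPair.comp (.const _) primrec_termCode_numeral)
  refine (primrec_infCode.comp
    (.const (formulaCode (floorAxioms ⊓ Formula.relabel (fun _ => 0) φ))) h).of_eq fun n => ?_
  rw [instantiate, formulaCode_inf (_ ⊓ _), formulaCode_equal, relabel_numeral]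
  simp [Term.relabel, termCode]

/-- The floor axioms fix `f` and the last equation fixes `x₀`, so nothing is left to choose.
Collapsing all variables to `x₀` is harmless because `φ` is only evaluated at constant assignments.
-/
theorem realSat_instantiate_iff (φ : orderedRingF.Formula ℕ) (n : ℕ) :
    RealSat (instantiate φ n) ↔ RealHolds (fun x : ℝ => (⌊x⌋ : ℝ)) φ fun _ => (n : ℝ) := by
  have holds_iff (f : ℝ → ℝ) (v : ℕ → ℝ) : RealHolds f (instantiate φ n) v ↔
      ((∀ x, f x = (⌊x⌋ : ℝ)) ∧ RealHolds f φ fun _ => v 0) ∧ v 0 = n := by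
    rw [instantiate, realHolds_inf, realHolds_inf, realHolds_floorAxioms_iff, realHolds_relabel,
      realHolds_equal, realize_numeral]
    rfl
  constructor
  · rintro ⟨f, v, h⟩
    obtain ⟨⟨hf, hφ⟩, hv⟩ := (holds_iff f v).1 h
    obtain rfl : f = fun x => (⌊x⌋ : ℝ) := funext hf
    rwa [hv] at hφ
  · exact fun h => ⟨_, fun _ => n, (holds_iff _ _).2 ⟨⟨fun _ => rfl, h⟩, rfl⟩⟩

theorem exists_realSat_instantiate_iff_dom {g : ℕ →. ℕ} (hg : Nat.Partrec g) :
    ∃ φ, ∀ n, RealSat (instantiate φ n) ↔ (g n).Dom := by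
  obtain ⟨φ, hφ⟩ := NatDefinable.exists' (P := fun y w => y ∈ g (w 0))
    ((natDefinable_of_partrec hg).relabel fun i => Nat.casesOn i 1 fun _ => 0)
  exact ⟨φ, fun n => (realSat_instantiate_iff φ n).trans
    ((hφ fun _ => n).trans Part.dom_iff_mem.symm)⟩

theorem not_decidableByAlgorithm_realSat : ¬ DecidableByAlgorithm RealSat := by
  rintro ⟨d, hd, hd'⟩
  -- A single partial recursive function whose domain is the halting set, so that `φ` is fixed and
  -- only the numeral varies.
  have hg : Nat.Partrec fun n => (Nat.Partrec.Code.ofNatCode n).eval 0 := by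
    refine Partrec.nat_iff.1 (Nat.Partrec.Code.eval_part.comp ?_ (Computable.const 0))
    exact Computable.ofNat Nat.Partrec.Code
  obtain ⟨φ, hφ⟩ := exists_realSat_instantiate_iff_dom hg
  refine ComputablePred.halting_problem 0 ?_
  refine ComputablePred.computable_iff.2
    ⟨fun c => d (formulaCode (instantiate φ (Encodable.encode c))), ?_, ?_⟩
  · exact hd.comp ((primrec_formulaCode_instantiate φ).to_comp.comp Computable.encode)
  · funext c
    rw [eq_iff_iff, hd', hφ]
    exact iff_of_eq (congrArg (fun c => (Nat.Partrec.Code.eval c 0).Dom)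
      (Denumerable.ofNat_encode c).symm)

end RealUF

open RealUF in
/-- Real arithmetic with one unary uninterpreted function is undecidable. Moreover, the two floor
axioms hold in `(ℝ, f)` exactly when `f` is the floor function, and `floorTranslation` is a computable
reduction of the satisfiability over `ℤ` of quantifier-free formulas `F(x₀, …, xₙ₋₁)` (in
particular of Diophantine equations) to satisfiability over the reals with `f`. -/
theorem lemma1 :
    ¬ DecidableByAlgorithm RealSat ∧
    (∀ (f : ℝ → ℝ) (v : ℕ → ℝ), RealHolds f floorAxioms v ↔ ∀ x : ℝ, f x = (⌊x⌋ : ℝ)) ∧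
    (∀ (n : ℕ) (v : ℕ → ℝ), RealHolds (fun x : ℝ => (⌊x⌋ : ℝ)) (integrality n) v ↔
      ∀ i < n, ∃ k : ℤ, v i = k) ∧
    (∃ T : ℕ × ℕ → ℕ, Computable T ∧ ∀ (n : ℕ) (F : orderedRing.Formula ℕ),
      T (n, formulaCode (embed F)) = formulaCode (floorTranslation n F)) ∧
    (∀ (n : ℕ) (F : orderedRing.Formula ℕ), BoundedFormula.IsQF F →
      F.freeVarFinset ⊆ Finset.range n → (IntSat F ↔ RealSat (floorTranslation n F))) :=
  ⟨not_decidableByAlgorithm_realSat, realHolds_floorAxioms_iff, realHolds_integrality,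
    exists_computable_formulaCode_floorTranslation, intSat_iff_realSat_floorTranslation⟩
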